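/- **Setting.** Let $|k,l\rangle$, $k,l\ge 0$, be the Fock basis of two optical modes and $\hat P_n$ the projector onto total photon number $n$. Let $\mu>0$, $\tau\in\mathbb R$, $\mathbf{R_0}=\{(q_1,q_2)\in\mathbb R^2:|q_1|<\tau,\ |q_2|>\tau\}$, and let $\mathcal N_E$ be an arbitrary quantum channel (a linear, completely positive, trace-preserving map on the trace-class operators of the two modes). Let $$\psi_n(q)=\frac{1}{\sqrt{2^n n!\sqrt{2\pi}}}H_n(q/\sqrt2)\,e^{-q^2/4},\qquad |q(\varphi)\rangle=\sum_n\psi_n(q)e^{in\varphi}|n\rangle ,$$ where $H_n$ are the physicists' Hermite polynomials; $|q(\varphi)\rangle$ is the generalized eigenvector of the quadrature $\hat a e^{-i\varphi}+\hat a^\dagger e^{i\varphi}$. Integrals of operators built from such vectors are understood through their Fock matrix elements. The source prepares the phase-randomized state $\hat\rho_{A'A_1A_2}=\int_0^{2\pi}\frac{d\varphi}{2\pi}|\Psi_\varphi\rangle\langle\Psi_\varphi|$ with $|\Psi_\varphi\rangle=\frac1{\sqrt2}\big(|0\rangle_{A'}|0\rangle|\sqrt\mu e^{i\varphi}\rangle+|1\rangle_{A'}|\sqrt\mu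 e^{i\varphi}\rangle|0\rangle\big)$, where $|\sqrt\mu e^{i\varphi}\rangle$ is a coherent state; it emits $m$ photons with probability $\Pr(m)=e^{-\mu}\mu^m/m!$. The squashing map from the two modes to a qubit $B'$ is $$\mathcal F(\hat\rho)=\int_0^{2\pi}\frac{d\varphi}{2\pi}\int_{\mathbf{R_0}}dq_1dq_2\,\hat K\hat\rho\hat K^\dagger,\qquad \hat K=|0\rangle\langle q_1(\varphi),q_2(\varphi)|+|1\rangle\langle q_2(\varphi),q_1(\varphi)|.$$ The gain $Q_{m,n}$ (the probability that $m$ photons are sent and $n$ are accepted) is the trace of $\mathcal F\{\hat P_n\,\mathcal N_E[\hat P_m\hat\rho_{A'A_1A_2}\hat P_m]\,\hat P_n\}=Q_{m,n}\hat\rho^{(m,n)}_{A'B'}$, the maps acting trivially on $A'$, and the phase-error rate is $e^X_{m,n}=\mathrm{Tr}[\hat\rho^{(m,n)}_{A'B'}(|{+-}\rangle\langle{+-}|+|{-+}\rangle\langle{-+}|)]$, with $|\pm\rangle=(|0\rangle\pm|1\rangle)/\sqrt2$ (so $Q_{m,n}e^X_{m,n}=0$ if $Q_{m,n}=0$). Let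 $|\Psi_m\rangle=\frac1{\sqrt2}(|0\rangle_{A'}|0m\rangle+|1\rangle_{A'}|m0\rangle)$, $|\Psi_m^\pm\rangle=\frac1{\sqrt2}(|0m\rangle\pm|m0\rangle)$, $\hat\rho_m=\mathrm{Tr}_{A'}|\Psi_m\rangle\langle\Psi_m|$, and $$\hat M_\pm=\frac12\int_{\mathbf{R_0}}dq_1dq_2\int_0^{2\pi}\frac{d\varphi}{2\pi}\big[|q_1(\varphi),q_2(\varphi)\rangle\pm|q_2(\varphi),q_1(\varphi)\rangle\big]\big[\langle q_1(\varphi),q_2(\varphi)|\pm\langle q_2(\varphi),q_1(\varphi)|\big].$$ **Proposition.** For all $m,n\ge0$, $$\frac{Q_{m,n}e^X_{m,n}}{\Pr(m)}=\frac12\mathrm{Tr}\big[\mathcal N_E(|\Psi_m^+\rangle\langle\Psi_m^+|)\hat P_n\hat M_-\hat P_n+\mathcal N_E(|\Psi_m^-\rangle\langle\Psi_m^-|)\hat P_n\hat M_+\hat P_n\big].$$ In particular, write $|\chi_n^\pm\rangle=\frac1{\sqrt2}(|0n\rangle\pm|n0\rangle)$ for the same vectors on the receiver's modes. For $m=n=1$,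 $$\frac{Q_{1,1}e^X_{1,1}}{\Pr(1)}=\frac{c_1}2\Big\{\mathrm{Tr}\big[\mathcal N_E(|\Psi_1^+\rangle\langle\Psi_1^+|)|\chi_1^-\rangle\langle\chi_1^-|\big]+\mathrm{Tr}\big[\mathcal N_E(|\Psi_1^-\rangle\langle\Psi_1^-|)|\chi_1^+\rangle\langle\chi_1^+|\big]\Big\},$$ $$\frac{Q_{1,1}}{\Pr(1)}=c_1\mathrm{Tr}\big\{\mathcal N_E(\hat\rho_1)(|01\rangle\langle01|+|10\rangle\langle10|)\big\},\qquad c_1=\int_{\mathbf{R_0}}\big[\psi_0^2(q_1)\psi_1^2(q_2)+\psi_0^2(q_2)\psi_1^2(q_1)\big]dq_1dq_2 .$$ For $m=n=2$, $$\frac{Q_{2,2}e^X_{2,2}}{\Pr(2)}=\tfrac12(c_2^{02}-d_2)\mathrm{Tr}\big[\mathcal N_E(|\Psi_2^+\rangle\langle\Psi_2^+|)|\chi_2^-\rangle\langle\chi_2^-|\big]+\tfrac12(c_2^{02}+d_2)\mathrm{Tr}\big[\mathcal N_E(|\Psi_2^-\rangle\langle\Psi_2^-|)|\chi_2^+\rangle\langle\chi_2^+|\big]+\tfrac12c_2^{11}\mathrm{Tr}\big[\mathcal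 N_E(|\Psi_2^-\rangle\langle\Psi_2^-|)|11\rangle\langle11|\big],$$ $$\frac{Q_{2,2}}{\Pr(2)}=c_2^{02}\mathrm{Tr}\{\mathcal N_E(\hat\rho_2)(|02\rangle\langle02|+|20\rangle\langle20|)\}+c_2^{11}\mathrm{Tr}\{\mathcal N_E(\hat\rho_2)|11\rangle\langle11|\}+d_2\mathrm{Tr}\{\mathcal N_E(\hat\rho_2)(|02\rangle\langle20|+|20\rangle\langle02|)\},$$ with $c_2^{02}=\int_{\mathbf{R_0}}[\psi_0^2(q_1)\psi_2^2(q_2)+\psi_2^2(q_1)\psi_0^2(q_2)]dq_1dq_2$, $c_2^{11}=\int_{\mathbf{R_0}}2\psi_1^2(q_1)\psi_1^2(q_2)dq_1dq_2$ and $d_2=\int_{\mathbf{R_0}}2\psi_0(q_1)\psi_2(q_1)\psi_0(q_2)\psi_2(q_2)dq_1dq_2$. -/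

import Mathlib

namespace TimeBinCV

open InnerProductSpace MeasureTheory
open scoped ComplexOrder

noncomputable section

/-! ### Two optical modes in the Fock representation -/

/-- The Hilbert space of two optical modes, with orthonormal Fock basis `|k, l⟩`,
`(k, l) : ℕ × ℕ`. -/
abbrev TwoMode : Type := lp (fun _ : ℕ × ℕ => ℂ) 2

/-- Bounded operators on the two modes. -/
abbrev Op : Type := TwoMode →L[ℂ] TwoMode

/-- The Fock state `|k, l⟩`. -/
def fock (k l : ℕ) : TwoMode := lp.single 2 (k, l) (1 : ℂ)

/-- The operator `|x⟩⟨y|`. -/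
def ketBra (x y : TwoMode) : Op := rankOne ℂ x y

/-- The Fock matrix element `⟨a| T |b⟩`. -/
def fockEntry (T : Op) (a b : ℕ × ℕ) : ℂ :=
  inner ℂ (fock a.1 a.2) (T (fock b.1 b.2))

/-- The trace, computed in the Fock basis. -/
def opTrace (T : Op) : ℂ := ∑' a : ℕ × ℕ, fockEntry T a a

/-- The absolute value `|T| = √(T† T)` of a bounded operator on a Hilbert space. -/
def absOp {H : Type*} [NormedAddCommGroup H] [InnerProductSpace ℂ H] [CompleteSpace H]
    (T : H →L[ℂ] H) : H →L[ℂ] H := CFC.abs T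

/-- `T` is trace class: `Tr |T| < ∞`. -/
def IsTraceClass (T : Op) : Prop :=
  Summable fun a : ℕ × ℕ => (fockEntry (absOp T) a a).re

/-- The projector `P_n` onto total photon number `n`. -/
def photonProj (n : ℕ) : Op :=
  ∑ a ∈ Finset.HasAntidiagonal.antidiagonal n, ketBra (fock a.1 a.2) (fock a.1 a.2)

/-- `P_n A P_n = ∑_{a, b} |a⟩⟨a| A |b⟩⟨b|` (over Fock labels `a`, `b` of total photon number `n`)
for an operator `A` that is given, in the weak sense, by its Fock matrix elements. -/
def photonBlock (n : ℕ) (A : Matrix (ℕ × ℕ) (ℕ × ℕ) ℂ) : Op :=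
  ∑ a ∈ Finset.HasAntidiagonal.antidiagonal n, ∑ b ∈ Finset.HasAntidiagonal.antidiagonal n,
    A a b • ketBra (fock a.1 a.2) (fock b.1 b.2)

/-! ### Quantum channels -/

/-- A matrix of operators is positive as an operator on `ℂ^k ⊗ TwoMode`. -/
def BlockPositive {k : ℕ} (ρ : Fin k → Fin k → Op) : Prop :=
  ∀ v : Fin k → TwoMode, 0 ≤ ∑ i, ∑ j, inner ℂ (v i) (ρ i j (v j))

/-- `N` is a quantum channel: on the trace-class operators it is linear, completely positive and
trace preserving.  (Its values on the other bounded operators carry no meaning; any linear map on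
the trace-class operators extends linearly to all of `Op`.) -/
structure IsChannel (N : Op →ₗ[ℂ] Op) : Prop where
  traceClass : ∀ ρ, IsTraceClass ρ → IsTraceClass (N ρ)
  trace_eq : ∀ ρ, IsTraceClass ρ → opTrace (N ρ) = opTrace ρ
  completelyPositive : ∀ (k : ℕ) (ρ : Fin k → Fin k → Op),
    (∀ i j, IsTraceClass (ρ i j)) → BlockPositive ρ → BlockPositive fun i j => N (ρ i j)

/-! ### The source -/

/-- Fock amplitude `⟨n|α⟩` of the coherent state `|α⟩`. -/
def coherentAmp (α : ℂ) (n : ℕ) : ℂ :=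
  (Real.exp (-‖α‖ ^ 2 / 2) : ℂ) * α ^ n / (Real.sqrt (n.factorial) : ℂ)

/-- Amplitude `⟨i|⟨a|` on `A' A₁ A₂` of
`(|0⟩ |0⟩|√μ e^{iφ}⟩ + |1⟩ |√μ e^{iφ}⟩|0⟩) / √2`. -/
def sourceAmp (μ φ : ℝ) (i : Fin 2) (a : ℕ × ℕ) : ℂ :=
  let α : ℂ := (Real.sqrt μ : ℂ) * Complex.exp (Complex.I * φ)
  (1 / Real.sqrt 2 : ℂ) *
    if i = 0 then coherentAmp 0 a.1 * coherentAmp α a.2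
    else coherentAmp α a.1 * coherentAmp 0 a.2

/-- Fock matrix of the block `⟨i| ρ |j⟩` (`i, j` labels of `A'`) of the phase-randomized
entangled source state. -/
def source (μ : ℝ) (i j : Fin 2) : Matrix (ℕ × ℕ) (ℕ × ℕ) ℂ := fun a b =>
  ∫ φ in (0 : ℝ)..(2 * Real.pi),
    (1 / (2 * Real.pi) : ℂ) * (sourceAmp μ φ i a * star (sourceAmp μ φ j b))

/-- The Poisson probability that the source emits `m` photons. -/
def prPhoton (μ : ℝ) (m : ℕ) : ℝ := Real.exp (-μ) * μ ^ m / m.factorial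

/-- `|Ψ_m⟩ = (|0⟩|0m⟩ + |1⟩|m0⟩)/√2`, as its two components along `A'`. -/
def psi (m : ℕ) (i : Fin 2) : TwoMode :=
  (1 / Real.sqrt 2 : ℂ) • if i = 0 then fock 0 m else fock m 0

/-- `|Ψ_m^s⟩ = (|0m⟩ + s |m0⟩)/√2`, used for `s = ±1`. -/
def psiPM (m : ℕ) (s : ℝ) : TwoMode :=
  (1 / Real.sqrt 2 : ℂ) • (fock 0 m + (s : ℂ) • fock m 0)

/-- `Tr_{A'} |Ψ_m⟩⟨Ψ_m|`. -/
def reducedPsi (m : ℕ) : Op := ∑ i : Fin 2, ketBra (psi m i) (psi m i)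

/-! ### Homodyne detection -/

/-- The physicists' Hermite polynomial `H_n`; Mathlib's `hermite` is the probabilists' one. -/
def physHermite (n : ℕ) (x : ℝ) : ℝ :=
  Real.sqrt 2 ^ n * Polynomial.aeval (Real.sqrt 2 * x) (Polynomial.hermite n)

/-- The coordinate representation `ψ_n` of the Fock state `|n⟩`. -/
def hermiteFun (n : ℕ) (q : ℝ) : ℝ :=
  1 / Real.sqrt (2 ^ n * n.factorial * Real.sqrt (2 * Real.pi)) *
    physHermite n (q / Real.sqrt 2) * Real.exp (-q ^ 2 / 4)

/-- Fock coefficient `⟨n|q(φ)⟩ = ψ_n(q) e^{inφ}` of the generalized eigenvector `|q(φ)⟩`, with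
eigenvalue `q`, of the quadrature `a e^{-iφ} + a† e^{iφ}`. -/
def quadKet (q φ : ℝ) (n : ℕ) : ℂ :=
  (hermiteFun n q : ℂ) * Complex.exp (Complex.I * n * φ)

/-- Fock coefficient `⟨a|q₁(φ), q₂(φ)⟩`. -/
def quadKet₂ (q₁ q₂ φ : ℝ) (a : ℕ × ℕ) : ℂ := quadKet q₁ φ a.1 * quadKet q₂ φ a.2

/-- The region `R₀` of quadratures decoded as the key bit `0`. -/
def regionZero (τ : ℝ) : Set (ℝ × ℝ) := {q | |q.1| < τ ∧ τ < |q.2|}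

/-- The operator `K^{(q₁,q₂,φ)} = |0⟩⟨q₁(φ),q₂(φ)| + |1⟩⟨q₂(φ),q₁(φ)|` from the two modes to the
qubit `B'`: its matrix elements `⟨k| K |a⟩`. -/
def krausAmp (q₁ q₂ φ : ℝ) (k : Fin 2) (a : ℕ × ℕ) : ℂ :=
  star (if k = 0 then quadKet₂ q₁ q₂ φ a else quadKet₂ q₂ q₁ φ a)

/-- The squashing map `ρ ↦ ∫ dφ/2π ∫_{R₀} dq₁ dq₂ K ρ K†`, as a matrix on the qubit `B'`.  It is
applied below to operators in a fixed photon-number space, where the sums are finite. -/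
def squash (τ : ℝ) (ρ : Op) : Matrix (Fin 2) (Fin 2) ℂ := fun k l =>
  ∫ φ in (0 : ℝ)..(2 * Real.pi), (1 / (2 * Real.pi) : ℂ) *
    ∫ q in regionZero τ, ∑' a : ℕ × ℕ, ∑' b : ℕ × ℕ,
      krausAmp q.1 q.2 φ k a * fockEntry ρ a b * star (krausAmp q.1 q.2 φ l b)

/-- Fock matrix of
`M_s = ½ ∫_{R₀} dq₁ dq₂ ∫ dφ/2π [|q₁,q₂⟩ + s|q₂,q₁⟩][⟨q₁,q₂| + s⟨q₂,q₁|]`, used for `s = ±1`. -/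
def compOp (τ s : ℝ) : Matrix (ℕ × ℕ) (ℕ × ℕ) ℂ := fun a b =>
  (1 / 2 : ℂ) * ∫ q in regionZero τ, ∫ φ in (0 : ℝ)..(2 * Real.pi), (1 / (2 * Real.pi) : ℂ) *
    ((quadKet₂ q.1 q.2 φ a + s * quadKet₂ q.2 q.1 φ a) *
      star (quadKet₂ q.1 q.2 φ b + s * quadKet₂ q.2 q.1 φ b))

/-! ### Gains and phase-error rates -/

/-- The unnormalized state on `A' B'` of the rounds where `m` photons are sent and `n` are
accepted: the source is projected onto `m` photons, sent through Eve's channel `N` (identity on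
`A'`), projected onto `n` photons and squashed. -/
def taggedState (μ τ : ℝ) (N : Op →ₗ[ℂ] Op) (m n : ℕ) :
    Matrix (Fin 2 × Fin 2) (Fin 2 × Fin 2) ℂ := fun x y =>
  squash τ (photonProj n ∘L N (photonBlock m (source μ x.1 y.1)) ∘L photonProj n) x.2 y.2

/-- The gain `Q_{m,n}`: the probability of sending `m` and accepting `n` photons. -/
def gain (μ τ : ℝ) (N : Op →ₗ[ℂ] Op) (m n : ℕ) : ℝ := (taggedState μ τ N m n).trace.re

/-- `|s⟩ = (|0⟩ + s|1⟩)/√2`, used for `s = ±1`. -/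
def xKet (s : ℝ) (i : Fin 2) : ℂ := (1 / Real.sqrt 2 : ℂ) * if i = 0 then 1 else (s : ℂ)

/-- The projector onto `|s⟩|t⟩` on the two qubits `A' B'`. -/
def xProj (s t : ℝ) : Matrix (Fin 2 × Fin 2) (Fin 2 × Fin 2) ℂ := fun x y =>
  xKet s x.1 * xKet t x.2 * star (xKet s y.1 * xKet t y.2)

/-- The phase-error rate `e^X_{m,n} = Tr[ρ^{(m,n)} (|+-⟩⟨+-| + |-+⟩⟨-+|)]` of the normalized state
`ρ^{(m,n)}` (of value `0` if the gain vanishes). -/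
def phaseErrorRate (μ τ : ℝ) (N : Op →ₗ[ℂ] Op) (m n : ℕ) : ℝ :=
  ((((gain μ τ N m n : ℂ)⁻¹ • taggedState μ τ N m n) *
    (xProj 1 (-1) + xProj (-1) 1)).trace).re

/-! ### Hermite-function integrals -/

/-- `c₁`. -/
def cOne (τ : ℝ) : ℝ := ∫ q in regionZero τ,
  (hermiteFun 0 q.1 ^ 2 * hermiteFun 1 q.2 ^ 2 + hermiteFun 0 q.2 ^ 2 * hermiteFun 1 q.1 ^ 2)

/-- `c₂^{02}`. -/
def cTwo02 (τ : ℝ) : ℝ := ∫ q in regionZero τ,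
  (hermiteFun 0 q.1 ^ 2 * hermiteFun 2 q.2 ^ 2 + hermiteFun 2 q.1 ^ 2 * hermiteFun 0 q.2 ^ 2)

/-- `c₂^{11}`. -/
def cTwo11 (τ : ℝ) : ℝ := ∫ q in regionZero τ,
  2 * hermiteFun 1 q.1 ^ 2 * hermiteFun 1 q.2 ^ 2

/-- `d₂`, the interference integral of `|02⟩` and `|20⟩`. -/
def dTwo (τ : ℝ) : ℝ := ∫ q in regionZero τ,
  2 * (hermiteFun 0 q.1 * hermiteFun 2 q.1) * (hermiteFun 0 q.2 * hermiteFun 2 q.2)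

end

end TimeBinCV

namespace TimeBinCV

open InnerProductSpace MeasureTheory
open scoped ComplexOrder

noncomputable section

/-! ### Fock matrix elements and traces -/

/-! All Fock amplitudes of `|q₁(φ), q₂(φ)⟩` with total photon number `n` carry the same phase
`e^{inφ}`. Inside one photon-number block the phase therefore cancels between ket and bra, and the
`φ`-averages are trivial (`quadKet₂_eq`). Since `R₀` is a product set, the remaining integrals are
products of one-dimensional overlaps of Hermite functions, inside and outside the threshold
(`overlap_eq`). At the source the same cancellation leaves `Pr(m) |Ψ_m⟩⟨Ψ_m|`
(`photonBlock_source`). The tagged state thus becomes a finite sum over Fock labels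
(`taggedState_eq`).

Testing it with `|s⟩|t⟩` turns `|Ψ_m⟩` into `|Ψ_m^s⟩/√2` on `A'`, and `K` into `(⟨q₁,q₂| +
t⟨q₂,q₁|)/√2` on `B'`. The latter integrates to `M_t`, so each of the two error outcomes contributes
`Pr(m)/2 · Tr[N(|Ψ_m^s⟩⟨Ψ_m^s|) P_n M_t P_n]` (`trace_taggedState_mul_xProj`).

The normalization in the error rate cancels because the gain is a real trace and the tagged state
vanishes when the gain does. Both follow from positivity (`posSemidef_taggedState`), hence from
complete positivity of the channel.

For one and two photons, parity kills the inner overlaps of Hermite functions of opposite parity.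
What survives is `P_1 M_s P_1 = c₁ |χ_1^s⟩⟨χ_1^s|` and `P_2 M_s P_2 = (c₂^{02} + s
d₂)|χ_2^s⟩⟨χ_2^s|`, plus `c₂^{11}|11⟩⟨11|` when `s = 1` only, since `|11⟩` is symmetric under
exchange of the modes. -/

theorem inner_fock_left (a : ℕ × ℕ) (x : TwoMode) : inner ℂ (fock a.1 a.2) x = x a := by
  simp [fock, lp.inner_single_left]

theorem inner_fock_right (a : ℕ × ℕ) (x : TwoMode) : inner ℂ x (fock a.1 a.2) = star (x a) := by
  simp [fock, lp.inner_single_right]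

theorem inner_fock_fock (a b : ℕ × ℕ) :
    inner ℂ (fock a.1 a.2) (fock b.1 b.2) = if a = b then (1 : ℂ) else 0 := by
  rw [inner_fock_left, fock, lp.single_apply]
  by_cases h : a = b <;> simp [h]

theorem norm_fock (a : ℕ × ℕ) : ‖fock a.1 a.2‖ = 1 := by
  rw [@norm_eq_sqrt_re_inner ℂ, inner_fock_fock, if_pos rfl]
  simp

/-- Parseval's identity in the Fock basis. The `HasSum` form carries convergence along, so traces of
finite sums can be split. -/
theorem hasSum_fockEntry_comp_ketBra (X : Op) (x y : TwoMode) :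
    HasSum (fun a => fockEntry (X ∘L ketBra x y) a a) (inner ℂ y (X x)) := by
  have h : (fun a => fockEntry (X ∘L ketBra x y) a a) = fun a => inner ℂ (y a) (X x a) := by
    funext a
    simp [fockEntry, ketBra, inner_fock_left, inner_fock_right, mul_comm]
  rw [h]
  exact lp.hasSum_inner y (X x)

theorem opTrace_comp_ketBra (X : Op) (x y : TwoMode) :
    opTrace (X ∘L ketBra x y) = inner ℂ y (X x) :=
  (hasSum_fockEntry_comp_ketBra X x y).tsum_eq

theorem fockEntry_add (S T : Op) (a b : ℕ × ℕ) :
    fockEntry (S + T) a b = fockEntry S a b + fockEntry T a b := by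
  simp [fockEntry]

theorem fockEntry_smul (c : ℂ) (T : Op) (a b : ℕ × ℕ) :
    fockEntry (c • T) a b = c * fockEntry T a b := by
  simp [fockEntry]

theorem fockEntry_sum {ι : Type*} (s : Finset ι) (T : ι → Op) (a b : ℕ × ℕ) :
    fockEntry (∑ i ∈ s, T i) a b = ∑ i ∈ s, fockEntry (T i) a b := by
  simp [fockEntry]

theorem opTrace_comp_smul_ketBra (X : Op) (c : ℂ) (x y : TwoMode) :
    opTrace (X ∘L (c • ketBra x y)) = c * inner ℂ y (X x) := by
  rw [← opTrace_comp_ketBra, opTrace, opTrace, ← tsum_mul_left]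
  simp [fockEntry_smul]

theorem opTrace_comp_ketBra_add (X : Op) (x y x' y' : TwoMode) :
    opTrace (X ∘L (ketBra x y + ketBra x' y')) = inner ℂ y (X x) + inner ℂ y' (X x') := by
  rw [opTrace, ← ((hasSum_fockEntry_comp_ketBra X x y).add
    (hasSum_fockEntry_comp_ketBra X x' y')).tsum_eq]
  simp [ContinuousLinearMap.comp_add, fockEntry_add]

theorem hasSum_fockEntry_comp_photonBlock (X : Op) (n : ℕ) (A : Matrix (ℕ × ℕ) (ℕ × ℕ) ℂ) :
    HasSum (fun c => fockEntry (X ∘L photonBlock n A) c c)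
      (∑ a ∈ Finset.HasAntidiagonal.antidiagonal n, ∑ b ∈ Finset.HasAntidiagonal.antidiagonal n,
        A a b * fockEntry X b a) := by
  have h := hasSum_sum (s := Finset.HasAntidiagonal.antidiagonal n) fun a _ =>
    hasSum_sum (s := Finset.HasAntidiagonal.antidiagonal n) fun b _ =>
      (hasSum_fockEntry_comp_ketBra X (fock a.1 a.2) (fock b.1 b.2)).mul_left (A a b)
  refine Eq.mp (congrArg (HasSum · _) (funext fun c => ?_)) h
  simp only [photonBlock, ContinuousLinearMap.comp_finsetSum, fockEntry_sum,
    ContinuousLinearMap.comp_smul, fockEntry_smul]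

theorem opTrace_comp_photonBlock_add (X Y : Op) (n : ℕ) (A B : Matrix (ℕ × ℕ) (ℕ × ℕ) ℂ) :
    opTrace (X ∘L photonBlock n A + Y ∘L photonBlock n B) =
      ∑ a ∈ Finset.HasAntidiagonal.antidiagonal n, ∑ b ∈ Finset.HasAntidiagonal.antidiagonal n,
        (A a b * fockEntry X b a + B a b * fockEntry Y b a) := by
  simp only [Finset.sum_add_distrib]
  rw [opTrace, ← ((hasSum_fockEntry_comp_photonBlock X n A).add
    (hasSum_fockEntry_comp_photonBlock Y n B)).tsum_eq]
  simp only [fockEntry_add]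

theorem photonProj_fock (n : ℕ) (b : ℕ × ℕ) :
    photonProj n (fock b.1 b.2) =
      if b ∈ Finset.HasAntidiagonal.antidiagonal n then fock b.1 b.2 else 0 := by
  simp [photonProj, ketBra, inner_fock_fock]

theorem inner_photonProj_left (n : ℕ) (x y : TwoMode) :
    inner ℂ x (photonProj n y) = inner ℂ (photonProj n x) y := by
  simp [photonProj, ketBra, mul_comm]

theorem fockEntry_photonProj_comp (X : Op) (n : ℕ) (a b : ℕ × ℕ) :
    fockEntry (photonProj n ∘L X ∘L photonProj n) a b =
      if a ∈ Finset.HasAntidiagonal.antidiagonal n ∧ b ∈ Finset.HasAntidiagonal.antidiagonal n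
        then fockEntry X a b else 0 := by
  simp only [fockEntry, ContinuousLinearMap.comp_apply]
  rw [inner_photonProj_left, photonProj_fock, photonProj_fock]
  by_cases ha : a ∈ Finset.HasAntidiagonal.antidiagonal n <;>
    by_cases hb : b ∈ Finset.HasAntidiagonal.antidiagonal n <;>
    simp only [ha, hb, if_true, if_false] <;> simp

/-- The absolute value is `‖c‖ |b⟩⟨b|`, with a single nonzero diagonal entry. This allows complete
positivity to be applied to the blocks of `|Ψ_m⟩⟨Ψ_m|`. -/
theorem isTraceClass_smul_ketBra_fock (c : ℂ) (a b : ℕ × ℕ) :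
    IsTraceClass (c • ketBra (fock a.1 a.2) (fock b.1 b.2)) := by
  have hp : IsStarProjection (ketBra (fock b.1 b.2) (fock b.1 b.2)) :=
    isStarProjection_rankOne_self (norm_fock b)
  have habs : absOp (c • ketBra (fock a.1 a.2) (fock b.1 b.2)) =
      ‖c‖ • ketBra (fock b.1 b.2) (fock b.1 b.2) := by
    rw [absOp, CFC.abs_smul, CFC.abs]
    congr 1
    -- The projector `|b⟩⟨b|` is positive and is its own square, so it is the square root of `T† T =
    -- |b⟩⟨b|`.
    refine CFC.sqrt_unique ?_ hp.nonneg
    rw [hp.isIdempotentElem.eq, ContinuousLinearMap.star_eq_adjoint, ketBra, ketBra,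
      adjoint_rankOne, ContinuousLinearMap.mul_def, rankOne_comp_rankOne, inner_fock_fock]
    simp
  rw [IsTraceClass, habs]
  refine summable_of_ne_finset_zero (s := {b}) fun d hd => ?_
  have hd' : d ≠ b := by simpa using hd
  simp [fockEntry, ketBra, inner_fock_fock, hd'.symm]

/-! ### Hermite functions -/

/-- The two rescalings by `√2` cancel, so parity and integrability can be read off the probabilists'
polynomial at `q`. -/
theorem hermiteFun_eq (n : ℕ) (q : ℝ) :
    hermiteFun n q = 1 / Real.sqrt (2 ^ n * n.factorial * Real.sqrt (2 * Real.pi)) *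
      Real.sqrt 2 ^ n * Polynomial.aeval q (Polynomial.hermite n) * Real.exp (-q ^ 2 / 4) := by
  have h : Real.sqrt 2 * (q / Real.sqrt 2) = q := by field_simp
  rw [hermiteFun, physHermite, h]
  ring

theorem hermiteFun_zero_neg (q : ℝ) : hermiteFun 0 (-q) = hermiteFun 0 q := by
  simp [hermiteFun_eq]

theorem hermiteFun_one_neg (q : ℝ) : hermiteFun 1 (-q) = -hermiteFun 1 q := by
  simp [hermiteFun_eq]

theorem hermiteFun_two_neg (q : ℝ) : hermiteFun 2 (-q) = hermiteFun 2 q := by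
  simp [hermiteFun_eq, Polynomial.hermite_succ]

theorem integrable_polynomial_mul_gaussian (p : Polynomial ℝ) {b : ℝ} (hb : 0 < b) :
    Integrable fun x : ℝ => p.eval x * Real.exp (-b * x ^ 2) := by
  induction p using Polynomial.induction_on' with
  | add p q hp hq =>
    simp only [Polynomial.eval_add, add_mul]
    exact hp.add hq
  | monomial n a =>
    have h := (integrable_rpow_mul_exp_neg_mul_sq hb
      (by linarith [n.cast_nonneg (α := ℝ)] : (-1 : ℝ) < n)).const_mul a
    simpa [mul_assoc] using h

theorem integrable_hermiteFun_mul (m n : ℕ) :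
    Integrable fun q : ℝ => hermiteFun m q * hermiteFun n q := by
  have h := (integrable_polynomial_mul_gaussian
    (((Polynomial.hermite m) * (Polynomial.hermite n)).map (Int.castRingHom ℝ))
    (by norm_num : (0 : ℝ) < 1 / 2)).const_mul
    (1 / Real.sqrt (2 ^ m * m.factorial * Real.sqrt (2 * Real.pi)) * Real.sqrt 2 ^ m *
      (1 / Real.sqrt (2 ^ n * n.factorial * Real.sqrt (2 * Real.pi)) * Real.sqrt 2 ^ n))
  refine h.congr (.of_forall fun q => ?_)
  have he : Real.exp (-(1 / 2) * q ^ 2) = Real.exp (-q ^ 2 / 4) * Real.exp (-q ^ 2 / 4) := by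
    rw [← Real.exp_add]; ring_nf
  simp only [hermiteFun_eq, he, Polynomial.map_mul, Polynomial.eval_mul, Polynomial.aeval_def,
    Polynomial.eval_map, algebraMap_int_eq]
  ring

/-- The overlap of `ψ_m` and `ψ_n` inside the threshold. -/
def innerOverlap (τ : ℝ) (m n : ℕ) : ℝ :=
  ∫ x in {x : ℝ | |x| < τ}, hermiteFun m x * hermiteFun n x

/-- The overlap of `ψ_m` and `ψ_n` outside the threshold. -/
def outerOverlap (τ : ℝ) (m n : ℕ) : ℝ :=
  ∫ x in {x : ℝ | τ < |x|}, hermiteFun m x * hermiteFun n x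

theorem innerOverlap_comm (τ : ℝ) (m n : ℕ) : innerOverlap τ m n = innerOverlap τ n m := by
  simp [innerOverlap, mul_comm]

theorem outerOverlap_comm (τ : ℝ) (m n : ℕ) : outerOverlap τ m n = outerOverlap τ n m := by
  simp [outerOverlap, mul_comm]

/-- Reflection preserves Lebesgue measure and the set, so the integral equals its own negative. -/
theorem setIntegral_eq_zero_of_odd {s : Set ℝ} (hs : MeasurableSet s)
    (hsymm : ∀ x, -x ∈ s ↔ x ∈ s) {f : ℝ → ℝ} (hf : ∀ x, f (-x) = -f x) :
    ∫ x in s, f x = 0 := by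
  rw [← integral_indicator hs]
  have h := integral_neg_eq_self (s.indicator f) volume
  have h' : ∀ x, s.indicator f (-x) = -s.indicator f x := fun x => by
    by_cases hx : x ∈ s
    · simp [hx, (hsymm x).2 hx, hf]
    · simp [hx, mt (hsymm x).1 hx]
  simp only [h', integral_neg] at h
  linarith

theorem measurableSet_abs_lt (τ : ℝ) : MeasurableSet {x : ℝ | |x| < τ} :=
  measurableSet_lt (by fun_prop) (by fun_prop)

theorem innerOverlap_zero_one (τ : ℝ) : innerOverlap τ 0 1 = 0 :=
  setIntegral_eq_zero_of_odd (measurableSet_abs_lt τ) (by simp)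
    fun x => by rw [hermiteFun_zero_neg, hermiteFun_one_neg]; ring

theorem innerOverlap_one_two (τ : ℝ) : innerOverlap τ 1 2 = 0 :=
  setIntegral_eq_zero_of_odd (measurableSet_abs_lt τ) (by simp)
    fun x => by rw [hermiteFun_two_neg, hermiteFun_one_neg]; ring

theorem regionZero_eq_prod (τ : ℝ) :
    regionZero τ = {x : ℝ | |x| < τ} ×ˢ {x : ℝ | τ < |x|} := by
  ext q; simp [regionZero]

/-- Fubini on the product set `R₀`: `q₁` lies inside the threshold and `q₂` outside it. -/
theorem setIntegral_regionZero_hermiteFun (τ : ℝ) (i j k l : ℕ) :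
    ∫ q in regionZero τ, (hermiteFun i q.1 * hermiteFun j q.1) *
      (hermiteFun k q.2 * hermiteFun l q.2) = innerOverlap τ i j * outerOverlap τ k l := by
  rw [regionZero_eq_prod]
  exact setIntegral_prod_mul (fun x => hermiteFun i x * hermiteFun j x)
    (fun x => hermiteFun k x * hermiteFun l x) _ _

theorem integrableOn_hermiteFun (τ : ℝ) (i j k l : ℕ) :
    IntegrableOn (fun q : ℝ × ℝ => (hermiteFun i q.1 * hermiteFun j q.1) *
      (hermiteFun k q.2 * hermiteFun l q.2)) (regionZero τ) :=
  ((integrable_hermiteFun_mul i j).mul_prod (integrable_hermiteFun_mul k l)).integrableOn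

theorem cOne_eq (τ : ℝ) : cOne τ =
    innerOverlap τ 0 0 * outerOverlap τ 1 1 + innerOverlap τ 1 1 * outerOverlap τ 0 0 := by
  rw [← setIntegral_regionZero_hermiteFun, ← setIntegral_regionZero_hermiteFun,
    ← integral_add (integrableOn_hermiteFun ..) (integrableOn_hermiteFun ..), cOne]
  congr 1; funext q; ring

theorem cTwo02_eq (τ : ℝ) : cTwo02 τ =
    innerOverlap τ 0 0 * outerOverlap τ 2 2 + innerOverlap τ 2 2 * outerOverlap τ 0 0 := by
  rw [← setIntegral_regionZero_hermiteFun, ← setIntegral_regionZero_hermiteFun,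
    ← integral_add (integrableOn_hermiteFun ..) (integrableOn_hermiteFun ..), cTwo02]
  congr 1; funext q; ring

theorem cTwo11_eq (τ : ℝ) : cTwo11 τ = 2 * (innerOverlap τ 1 1 * outerOverlap τ 1 1) := by
  rw [← setIntegral_regionZero_hermiteFun, ← integral_const_mul, cTwo11]
  congr 1; funext q; ring

theorem dTwo_eq (τ : ℝ) : dTwo τ = 2 * (innerOverlap τ 0 2 * outerOverlap τ 0 2) := by
  rw [← setIntegral_regionZero_hermiteFun, ← integral_const_mul, dTwo]
  congr 1; funext q; ring

/-! ### Quadrature amplitudes -/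

/-- The phase-free part of `⟨a|q₁(φ), q₂(φ)⟩` (for `k = 0`) and of `⟨a|q₂(φ), q₁(φ)⟩`
(for `k = 1`). -/
def modeAmp (q : ℝ × ℝ) (k : Fin 2) (a : ℕ × ℕ) : ℝ :=
  if k = 0 then hermiteFun a.1 q.1 * hermiteFun a.2 q.2
  else hermiteFun a.1 q.2 * hermiteFun a.2 q.1

/-- The integral of a product of two quadrature amplitudes over the region `R₀`. -/
def overlap (τ : ℝ) (k l : Fin 2) (a b : ℕ × ℕ) : ℝ :=
  ∫ q in regionZero τ, modeAmp q k a * modeAmp q l b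

/-- The Hermite indices `(i, j)` of `ψ_i(q₁) ψ_j(q₂) = modeAmp q k a`. -/
def modeIndex (k : Fin 2) (a : ℕ × ℕ) : ℕ × ℕ := if k = 0 then a else a.swap

/-- Exchanging the quadratures amounts to exchanging the Fock labels, so the factors can be grouped
by variable. -/
theorem modeAmp_mul (q : ℝ × ℝ) (k l : Fin 2) (a b : ℕ × ℕ) :
    modeAmp q k a * modeAmp q l b =
      (hermiteFun (modeIndex k a).1 q.1 * hermiteFun (modeIndex l b).1 q.1) *
        (hermiteFun (modeIndex k a).2 q.2 * hermiteFun (modeIndex l b).2 q.2) := by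
  simp only [modeAmp, modeIndex]
  split_ifs <;> (try simp only [Prod.fst_swap, Prod.snd_swap]) <;> ring

theorem overlap_eq (τ : ℝ) (k l : Fin 2) (a b : ℕ × ℕ) :
    overlap τ k l a b = innerOverlap τ (modeIndex k a).1 (modeIndex l b).1 *
      outerOverlap τ (modeIndex k a).2 (modeIndex l b).2 := by
  simp only [overlap, modeAmp_mul, setIntegral_regionZero_hermiteFun]

theorem integrableOn_modeAmp_mul (τ : ℝ) (k l : Fin 2) (a b : ℕ × ℕ) :
    IntegrableOn (fun q => modeAmp q k a * modeAmp q l b) (regionZero τ) := by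
  simpa only [modeAmp_mul] using integrableOn_hermiteFun τ _ _ _ _

/-- The phases of the two modes multiply to one that depends only on the total photon number, hence
is common to the whole block. -/
theorem quadKet₂_eq (q : ℝ × ℝ) (φ : ℝ) {n : ℕ} {a : ℕ × ℕ}
    (ha : a ∈ Finset.HasAntidiagonal.antidiagonal n) (k : Fin 2) :
    (if k = 0 then quadKet₂ q.1 q.2 φ a else quadKet₂ q.2 q.1 φ a) =
      (modeAmp q k a : ℂ) * Complex.exp (Complex.I * n * φ) := by
  have hn : (n : ℂ) = a.1 + a.2 := by
    exact_mod_cast (Finset.HasAntidiagonal.mem_antidiagonal.1 ha).symm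
  have he : Complex.exp (Complex.I * n * φ) =
      Complex.exp (Complex.I * a.1 * φ) * Complex.exp (Complex.I * a.2 * φ) := by
    rw [← Complex.exp_add, hn]; ring_nf
  simp only [modeAmp, quadKet₂, quadKet, he]
  split_ifs <;> push_cast <;> ring

theorem exp_I_mul_mul_star (n : ℕ) (φ : ℝ) :
    Complex.exp (Complex.I * n * φ) * star (Complex.exp (Complex.I * n * φ)) = 1 := by
  have h : ‖Complex.exp (Complex.I * n * φ)‖ = 1 := by
    have : Complex.I * n * φ = ((n * φ : ℝ) : ℂ) * Complex.I := by push_cast; ring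
    rw [this, Complex.norm_exp_ofReal_mul_I]
  rw [Complex.star_def, Complex.mul_conj']
  simp [h]

theorem phaseAverage_const (c : ℂ) :
    ∫ _φ in (0 : ℝ)..(2 * Real.pi), (1 / (2 * Real.pi) : ℂ) * c = c := by
  rw [intervalIntegral.integral_const]
  have : (Real.pi : ℂ) ≠ 0 := by exact_mod_cast Real.pi_ne_zero
  simp only [sub_zero, Complex.real_smul]
  push_cast
  field_simp

theorem compOp_eq (τ s : ℝ) {n : ℕ} {a b : ℕ × ℕ}
    (ha : a ∈ Finset.HasAntidiagonal.antidiagonal n)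
    (hb : b ∈ Finset.HasAntidiagonal.antidiagonal n) :
    compOp τ s a b = (1 / 2 : ℂ) * (overlap τ 0 0 a b + s * overlap τ 0 1 a b +
      s * overlap τ 1 0 a b + s ^ 2 * overlap τ 1 1 a b) := by
  have hpt : ∀ (q : ℝ × ℝ) (φ : ℝ),
      (quadKet₂ q.1 q.2 φ a + s * quadKet₂ q.2 q.1 φ a) *
        star (quadKet₂ q.1 q.2 φ b + s * quadKet₂ q.2 q.1 φ b) =
      ((modeAmp q 0 a * modeAmp q 0 b + s * (modeAmp q 0 a * modeAmp q 1 b) +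
        s * (modeAmp q 1 a * modeAmp q 0 b) + s ^ 2 * (modeAmp q 1 a * modeAmp q 1 b) : ℝ) : ℂ) := by
    intro q φ
    have h0 := fun {c} hc => quadKet₂_eq q φ (a := c) (n := n) hc 0
    have h1 := fun {c} hc => quadKet₂_eq q φ (a := c) (n := n) hc 1
    simp only [if_true, one_ne_zero, if_false] at h0 h1
    rw [h0 ha, h1 ha, h0 hb, h1 hb]
    simp only [star_add, star_mul', Complex.star_def, Complex.conj_ofReal]
    have he := exp_I_mul_mul_star n φ
    rw [Complex.star_def] at he
    push_cast
    -- The two sides differ only by the factor `e^{inφ}` times its conjugate, which `he` sets to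
    -- `1`.
    linear_combination ((modeAmp q 0 a : ℂ) + s * modeAmp q 1 a) *
      (modeAmp q 0 b + s * modeAmp q 1 b) * he
  simp only [compOp, hpt, phaseAverage_const]
  rw [integral_complex_ofReal]
  have hi := integrableOn_modeAmp_mul τ
  rw [integral_add, integral_add, integral_add]
  · simp only [integral_const_mul, overlap]
    push_cast
    rfl
  · exact hi ..
  · exact (hi ..).const_mul _
  · exact (hi ..).add ((hi ..).const_mul _)
  · exact (hi ..).const_mul _
  · exact ((hi ..).add ((hi ..).const_mul _)).add ((hi ..).const_mul _)
  · exact (hi ..).const_mul _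

theorem squash_photonProj_integrand (X : Op) (n : ℕ) (k l : Fin 2) (q : ℝ × ℝ) (φ : ℝ) :
    ∑' a : ℕ × ℕ, ∑' b : ℕ × ℕ, krausAmp q.1 q.2 φ k a *
        fockEntry (photonProj n ∘L X ∘L photonProj n) a b * star (krausAmp q.1 q.2 φ l b) =
      ∑ a ∈ Finset.HasAntidiagonal.antidiagonal n, ∑ b ∈ Finset.HasAntidiagonal.antidiagonal n,
        fockEntry X a b * ((modeAmp q k a * modeAmp q l b : ℝ) : ℂ) := by
  simp only [fockEntry_photonProj_comp]
  rw [tsum_eq_sum (s := Finset.HasAntidiagonal.antidiagonal n)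
    (fun a ha => by simp only [ha, false_and, if_false, mul_zero, zero_mul, tsum_zero])]
  refine Finset.sum_congr rfl fun a ha => ?_
  rw [tsum_eq_sum (s := Finset.HasAntidiagonal.antidiagonal n)
    (fun b hb => by simp only [hb, and_false, if_false, mul_zero, zero_mul])]
  refine Finset.sum_congr rfl fun b hb => ?_
  rw [if_pos ⟨ha, hb⟩, krausAmp, krausAmp, quadKet₂_eq q φ ha, quadKet₂_eq q φ hb, star_star]
  have he := exp_I_mul_mul_star n φ
  simp only [star_mul', Complex.star_def, Complex.conj_ofReal] at he ⊢
  push_cast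
  linear_combination (modeAmp q k a : ℂ) * fockEntry X a b * modeAmp q l b * he

/-- The finite sum stays under the integral here because positivity will be checked pointwise in
`q`. -/
theorem squash_photonProj_eq_integral (τ : ℝ) (X : Op) (n : ℕ) (k l : Fin 2) :
    squash τ (photonProj n ∘L X ∘L photonProj n) k l =
      ∫ q in regionZero τ, ∑ a ∈ Finset.HasAntidiagonal.antidiagonal n,
        ∑ b ∈ Finset.HasAntidiagonal.antidiagonal n,
          fockEntry X a b * ((modeAmp q k a * modeAmp q l b : ℝ) : ℂ) := by
  simp only [squash, squash_photonProj_integrand, phaseAverage_const]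

theorem integrableOn_entry_mul_modeAmp (τ : ℝ) (c : ℂ) (k l : Fin 2) (a b : ℕ × ℕ) :
    IntegrableOn (fun q => c * ((modeAmp q k a * modeAmp q l b : ℝ) : ℂ)) (regionZero τ) :=
  (integrableOn_modeAmp_mul τ k l a b).ofReal.const_mul c

theorem squash_photonProj (τ : ℝ) (X : Op) (n : ℕ) (k l : Fin 2) :
    squash τ (photonProj n ∘L X ∘L photonProj n) k l =
      ∑ a ∈ Finset.HasAntidiagonal.antidiagonal n, ∑ b ∈ Finset.HasAntidiagonal.antidiagonal n,
        fockEntry X a b * overlap τ k l a b := by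
  rw [squash_photonProj_eq_integral, integral_finsetSum _ fun a _ =>
    integrable_finsetSum _ fun b _ => integrableOn_entry_mul_modeAmp τ _ k l a b]
  refine Finset.sum_congr rfl fun a _ => ?_
  rw [integral_finsetSum _ fun b _ => integrableOn_entry_mul_modeAmp τ _ k l a b]
  refine Finset.sum_congr rfl fun b _ => ?_
  rw [integral_const_mul, integral_complex_ofReal, overlap]

/-! ### The source in a fixed photon-number space -/

/-- The Fock label of the signal `|0m⟩` (for `i = 0`) or `|m0⟩` (for `i = 1`). -/
def signalLabel (m : ℕ) (i : Fin 2) : ℕ × ℕ := if i = 0 then (0, m) else (m, 0)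

theorem signalLabel_mem (m : ℕ) (i : Fin 2) :
    signalLabel m i ∈ Finset.HasAntidiagonal.antidiagonal m := by
  rw [Finset.HasAntidiagonal.mem_antidiagonal, signalLabel]
  split_ifs <;> simp

theorem psi_eq (m : ℕ) (i : Fin 2) :
    psi m i = (1 / Real.sqrt 2 : ℂ) • fock (signalLabel m i).1 (signalLabel m i).2 := by
  rw [psi, signalLabel]
  split_ifs <;> rfl

theorem one_div_sqrt_two_mul_self : (1 / Real.sqrt 2 : ℂ) * (1 / Real.sqrt 2 : ℂ) = 1 / 2 := by
  have h : (Real.sqrt 2 : ℂ) * Real.sqrt 2 = 2 := by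
    exact_mod_cast Real.mul_self_sqrt (by norm_num : (0 : ℝ) ≤ 2)
  rw [div_mul_div_comm, h, one_mul]

theorem star_one_div_sqrt_two : star (1 / Real.sqrt 2 : ℂ) = (1 / Real.sqrt 2 : ℂ) := by
  rw [star_div₀, star_one, Complex.star_def, Complex.conj_ofReal]

theorem ketBra_psi (m : ℕ) (i j : Fin 2) :
    ketBra (psi m i) (psi m j) = (1 / 2 : ℂ) • ketBra
      (fock (signalLabel m i).1 (signalLabel m i).2)
      (fock (signalLabel m j).1 (signalLabel m j).2) := by
  rw [psi_eq, psi_eq, ketBra, ketBra, ContinuousLinearMap.map_smulₛₗ, starRingEnd_apply,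
    star_one_div_sqrt_two, map_smul, smul_apply, smul_smul, one_div_sqrt_two_mul_self]

theorem coherentAmp_zero (n : ℕ) : coherentAmp 0 n = if n = 0 then 1 else 0 := by
  by_cases h : n = 0 <;> simp [coherentAmp, h]

/-- One mode is in the vacuum, so among labels of total `m` only `(0, m)` or `(m, 0)` has a nonzero
amplitude. -/
theorem sourceAmp_eq (μ φ : ℝ) {m : ℕ} {a : ℕ × ℕ}
    (ha : a ∈ Finset.HasAntidiagonal.antidiagonal m) (i : Fin 2) :
    sourceAmp μ φ i a = if a = signalLabel m i then (1 / Real.sqrt 2 : ℂ) *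
      coherentAmp ((Real.sqrt μ : ℂ) * Complex.exp (Complex.I * φ)) m else 0 := by
  obtain ⟨k, l⟩ := a
  have hm : k + l = m := Finset.HasAntidiagonal.mem_antidiagonal.1 ha
  simp only [sourceAmp, signalLabel, coherentAmp_zero]
  by_cases hi : i = 0
  · by_cases hk : k = 0
    · have : l = m := by omega
      simp [hi, hk, this]
    · simp [hi, hk]
  · by_cases hl : l = 0
    · have : k = m := by omega
      simp [hi, hl, this]
    · simp [hi, hl]

/-- Only the modulus `√μ` enters, so the phase drops out and the Poisson weight appears. -/
theorem coherentAmp_mul_star (μ φ : ℝ) (hμ : 0 ≤ μ) (m : ℕ) :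
    coherentAmp ((Real.sqrt μ : ℂ) * Complex.exp (Complex.I * φ)) m *
      star (coherentAmp ((Real.sqrt μ : ℂ) * Complex.exp (Complex.I * φ)) m) = prPhoton μ m := by
  have hα : ‖(Real.sqrt μ : ℂ) * Complex.exp (Complex.I * φ)‖ = Real.sqrt μ := by
    rw [norm_mul, mul_comm Complex.I, Complex.norm_exp_ofReal_mul_I, mul_one, Complex.norm_real,
      Real.norm_of_nonneg (Real.sqrt_nonneg μ)]
  have hn : ‖coherentAmp ((Real.sqrt μ : ℂ) * Complex.exp (Complex.I * φ)) m‖ =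
      Real.exp (-μ / 2) * Real.sqrt μ ^ m / Real.sqrt m.factorial := by
    rw [coherentAmp, norm_div, norm_mul, norm_pow, hα, Real.sq_sqrt hμ, Complex.norm_real,
      Complex.norm_real, Real.norm_of_nonneg (Real.exp_nonneg _),
      Real.norm_of_nonneg (Real.sqrt_nonneg _)]
  rw [Complex.star_def, Complex.mul_conj', hn, ← Complex.ofReal_pow]
  congr 1
  rw [div_pow, mul_pow, Real.sq_sqrt (Nat.cast_nonneg _), ← pow_mul, mul_comm m 2, pow_mul,
    Real.sq_sqrt hμ, ← Real.exp_nat_mul, prPhoton]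
  congr 3
  push_cast
  ring

theorem source_eq (μ : ℝ) (hμ : 0 ≤ μ) {m : ℕ} {a b : ℕ × ℕ}
    (ha : a ∈ Finset.HasAntidiagonal.antidiagonal m)
    (hb : b ∈ Finset.HasAntidiagonal.antidiagonal m) (i j : Fin 2) :
    source μ i j a b = if a = signalLabel m i then
      if b = signalLabel m j then (prPhoton μ m : ℂ) * (1 / 2) else 0 else 0 := by
  have hpt : ∀ φ : ℝ, sourceAmp μ φ i a * star (sourceAmp μ φ j b) =
      if a = signalLabel m i then
        if b = signalLabel m j then (prPhoton μ m : ℂ) * (1 / 2) else 0 else 0 := by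
    intro φ
    rw [sourceAmp_eq μ φ ha, sourceAmp_eq μ φ hb]
    split_ifs
    · rw [star_mul', star_one_div_sqrt_two, mul_mul_mul_comm, one_div_sqrt_two_mul_self,
        coherentAmp_mul_star μ φ hμ, mul_comm]
    all_goals simp
  simp only [source, hpt, phaseAverage_const]

/-- Both branches of the source carry the same phase `e^{imφ}`, so phase randomization preserves
their coherence at fixed `m`. -/
theorem photonBlock_source (μ : ℝ) (hμ : 0 ≤ μ) (m : ℕ) (i j : Fin 2) :
    photonBlock m (source μ i j) = (prPhoton μ m : ℂ) • ketBra (psi m i) (psi m j) := by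
  have h : photonBlock m (source μ i j) =
      ∑ a ∈ Finset.HasAntidiagonal.antidiagonal m, ∑ b ∈ Finset.HasAntidiagonal.antidiagonal m,
        if a = signalLabel m i then if b = signalLabel m j then
          ((prPhoton μ m : ℂ) * (1 / 2)) • ketBra (fock a.1 a.2) (fock b.1 b.2) else 0 else 0 := by
    refine Finset.sum_congr rfl fun a ha => Finset.sum_congr rfl fun b hb => ?_
    rw [source_eq μ hμ ha hb]
    split_ifs <;> simp
  rw [h, Finset.sum_eq_single (signalLabel m i), Finset.sum_eq_single (signalLabel m j), if_pos rfl,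
    if_pos rfl, ketBra_psi, smul_smul]
  · intro b _ hb; simp [hb]
  · intro hb; exact absurd (signalLabel_mem m j) hb
  · intro a _ ha; simp [ha]
  · intro ha; exact absurd (signalLabel_mem m i) ha

/-- The quadratic form is the squared modulus of `∑ i, ⟨x i, v i⟩`. -/
theorem blockPositive_ketBra {k : ℕ} (x : Fin k → TwoMode) :
    BlockPositive fun i j => ketBra (x i) (x j) := by
  intro v
  have h : ∑ i, ∑ j, inner ℂ (v i) (ketBra (x i) (x j) (v j)) =
      star (∑ i, inner ℂ (x i) (v i)) * ∑ j, inner ℂ (x j) (v j) := by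
    rw [star_sum, Finset.sum_mul_sum]
    refine Finset.sum_congr rfl fun i _ => Finset.sum_congr rfl fun j _ => ?_
    rw [ketBra, inner_right_rankOne_apply, Complex.star_def, inner_conj_symm]
  rw [h]
  exact star_mul_self_nonneg _

/-- Complete positivity with the qubit `A'` as the two-dimensional ancilla. -/
theorem blockPositive_channel {N : Op →ₗ[ℂ] Op} (hN : IsChannel N) (m : ℕ) :
    BlockPositive fun i j : Fin 2 => N (ketBra (psi m i) (psi m j)) :=
  hN.completelyPositive 2 _
    (fun i j => by rw [ketBra_psi]; exact isTraceClass_smul_ketBra_fock _ _ _)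
    (blockPositive_ketBra _)

/-! ### The tagged state -/

theorem taggedState_eq_squash (μ τ : ℝ) (hμ : 0 ≤ μ) (N : Op →ₗ[ℂ] Op) (m n : ℕ)
    (x y : Fin 2 × Fin 2) :
    taggedState μ τ N m n x y = (prPhoton μ m : ℂ) *
      squash τ (photonProj n ∘L N (ketBra (psi m x.1) (psi m y.1)) ∘L photonProj n) x.2 y.2 := by
  rw [taggedState, photonBlock_source μ hμ, map_smul, squash_photonProj, squash_photonProj]
  simp only [fockEntry_smul, Finset.mul_sum, mul_assoc]

theorem taggedState_eq (μ τ : ℝ) (hμ : 0 ≤ μ) (N : Op →ₗ[ℂ] Op) (m n : ℕ)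
    (x y : Fin 2 × Fin 2) :
    taggedState μ τ N m n x y = (prPhoton μ m : ℂ) *
      ∑ a ∈ Finset.HasAntidiagonal.antidiagonal n, ∑ b ∈ Finset.HasAntidiagonal.antidiagonal n,
        fockEntry (N (ketBra (psi m x.1) (psi m y.1))) a b * overlap τ x.2 y.2 a b := by
  rw [taggedState_eq_squash μ τ hμ, squash_photonProj]

theorem prPhoton_nonneg (μ : ℝ) (hμ : 0 ≤ μ) (m : ℕ) : 0 ≤ prPhoton μ m := by
  unfold prPhoton; positivity

/-! ### Positivity of the tagged state -/

theorem inner_fockSum (S : Finset (ℕ × ℕ)) (X : Op) (f g : ℕ × ℕ → ℂ) :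
    inner ℂ (∑ a ∈ S, f a • fock a.1 a.2) (X (∑ b ∈ S, g b • fock b.1 b.2)) =
      ∑ a ∈ S, ∑ b ∈ S, star (f a) * fockEntry X a b * g b := by
  rw [map_sum, sum_inner]
  simp only [map_smul, inner_sum, inner_smul_left, inner_smul_right, fockEntry, Complex.star_def]
  refine Finset.sum_congr rfl fun a _ => Finset.sum_congr rfl fun b _ => ?_
  ring

theorem quadForm_modeAmp_nonneg {X : Fin 2 → Fin 2 → Op} (hX : BlockPositive X)
    (S : Finset (ℕ × ℕ)) (q : ℝ × ℝ) (w : Fin 2 × Fin 2 → ℂ) :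
    0 ≤ ∑ x : Fin 2 × Fin 2, ∑ y : Fin 2 × Fin 2, star (w x) * (∑ a ∈ S, ∑ b ∈ S,
      fockEntry (X x.1 y.1) a b * ((modeAmp q x.2 a * modeAmp q y.2 b : ℝ) : ℂ)) * w y := by
  -- The test vector is `K†` applied to `w` on `B'`, with the phase removed and restricted to `S`.
  refine (hX fun i => ∑ a ∈ S, (∑ k, w (i, k) * modeAmp q k a) • fock a.1 a.2).trans_eq ?_
  simp only [inner_fockSum, Fintype.sum_prod_type, Fin.sum_univ_two, Finset.mul_sum,
    Finset.sum_mul, ← Finset.sum_add_distrib]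
  refine Finset.sum_congr rfl fun a _ => Finset.sum_congr rfl fun b _ => ?_
  simp only [star_add, star_mul', Complex.star_def, Complex.conj_ofReal]
  push_cast
  ring

/-- A nonnegative complex number is real, and over `ℂ` a real quadratic form forces symmetry by
polarization. -/
theorem isHermitian_of_quadForm_nonneg {ι : Type*} [Fintype ι] [DecidableEq ι]
    {A : Matrix ι ι ℂ} (h : ∀ w, 0 ≤ star w ⬝ᵥ A.mulVec w) : A.IsHermitian := by
  rw [← Matrix.isSymmetric_toEuclideanLin_iff, LinearMap.isSymmetric_iff_inner_map_self_real]
  intro v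
  have hv := (Complex.nonneg_iff.1 (h v.ofLp)).2
  rw [Complex.conj_eq_iff_im, ← inner_conj_symm, Complex.conj_im,
    EuclideanSpace.inner_eq_star_dotProduct, Matrix.ofLp_toLpLin, Matrix.toLin'_apply,
    dotProduct_comm, ← hv, neg_zero]

/-- Its quadratic form is `Pr(m)` times the integral over `R₀` of a form that is nonnegative at
every `q`. -/
theorem posSemidef_taggedState (μ τ : ℝ) (hμ : 0 ≤ μ) {N : Op →ₗ[ℂ] Op} (hN : IsChannel N)
    (m n : ℕ) : (taggedState μ τ N m n).PosSemidef := by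
  have h : ∀ w, 0 ≤ star w ⬝ᵥ (taggedState μ τ N m n).mulVec w := by
    intro w
    have hform : star w ⬝ᵥ (taggedState μ τ N m n).mulVec w = (prPhoton μ m : ℂ) *
        ∫ q in regionZero τ, ∑ x : Fin 2 × Fin 2, ∑ y : Fin 2 × Fin 2, star (w x) *
          (∑ a ∈ Finset.HasAntidiagonal.antidiagonal n,
            ∑ b ∈ Finset.HasAntidiagonal.antidiagonal n,
              fockEntry (N (ketBra (psi m x.1) (psi m y.1))) a b *
                ((modeAmp q x.2 a * modeAmp q y.2 b : ℝ) : ℂ)) * w y := by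
      have hint : ∀ x y : Fin 2 × Fin 2, IntegrableOn (fun q => star (w x) *
          (∑ a ∈ Finset.HasAntidiagonal.antidiagonal n,
            ∑ b ∈ Finset.HasAntidiagonal.antidiagonal n,
              fockEntry (N (ketBra (psi m x.1) (psi m y.1))) a b *
                ((modeAmp q x.2 a * modeAmp q y.2 b : ℝ) : ℂ)) * w y) (regionZero τ) :=
        fun x y => ((integrable_finsetSum _ fun a _ => integrable_finsetSum _ fun b _ =>
          integrableOn_entry_mul_modeAmp τ _ x.2 y.2 a b).const_mul _).mul_const _
      rw [integral_finsetSum _ fun x _ => integrable_finsetSum _ fun y _ => hint x y]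
      rw [dotProduct, Finset.mul_sum]
      refine Finset.sum_congr rfl fun x _ => ?_
      rw [integral_finsetSum _ fun y _ => hint x y, Finset.mul_sum, Matrix.mulVec, dotProduct,
        Finset.mul_sum, Pi.star_apply]
      refine Finset.sum_congr rfl fun y _ => ?_
      rw [integral_mul_const, integral_const_mul, ← squash_photonProj_eq_integral,
        taggedState_eq_squash μ τ hμ]
      ring
    rw [hform]
    refine mul_nonneg (by exact_mod_cast prPhoton_nonneg μ hμ m) (integral_nonneg fun q => ?_)
    exact quadForm_modeAmp_nonneg (blockPositive_channel hN m) _ q w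
  exact .of_dotProduct_mulVec_nonneg (isHermitian_of_quadForm_nonneg h) h

theorem isHermitian_xProj (s t : ℝ) : (xProj s t).IsHermitian := by
  ext x y
  simp only [Matrix.conjTranspose_apply, xProj, star_mul', star_star]
  ring

theorem ofReal_re_trace_mul {ι : Type*} [Fintype ι] {A B : Matrix ι ι ℂ} (hA : A.IsHermitian)
    (hB : B.IsHermitian) : (((A * B).trace.re : ℝ) : ℂ) = (A * B).trace := by
  rw [← Complex.conj_eq_iff_re, ← Complex.star_def, ← Matrix.trace_conjTranspose,
    Matrix.conjTranspose_mul, hA.eq, hB.eq, Matrix.trace_mul_comm]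

theorem ofReal_gain (μ τ : ℝ) (hμ : 0 ≤ μ) {N : Op →ₗ[ℂ] Op} (hN : IsChannel N) (m n : ℕ) :
    (gain μ τ N m n : ℂ) = (taggedState μ τ N m n).trace := by
  have h := ofReal_re_trace_mul (posSemidef_taggedState μ τ hμ hN m n).isHermitian
    Matrix.isHermitian_one
  rwa [mul_one] at h

theorem ofReal_gain_mul_phaseErrorRate (μ τ : ℝ) (hμ : 0 ≤ μ) {N : Op →ₗ[ℂ] Op}
    (hN : IsChannel N) (m n : ℕ) :
    ((gain μ τ N m n * phaseErrorRate μ τ N m n : ℝ) : ℂ) =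
      (taggedState μ τ N m n * (xProj 1 (-1) + xProj (-1) 1)).trace := by
  have hT := posSemidef_taggedState μ τ hμ hN m n
  by_cases hg : gain μ τ N m n = 0
  -- A positive semidefinite matrix of trace zero vanishes, so the unnormalized error is zero as
  -- well.
  · have h0 : taggedState μ τ N m n = 0 := by
      rw [← hT.trace_eq_zero_iff, ← ofReal_gain μ τ hμ hN, hg, Complex.ofReal_zero]
    simp [hg, h0]
  · rw [← ofReal_re_trace_mul hT.isHermitian
      ((isHermitian_xProj 1 (-1)).add (isHermitian_xProj (-1) 1)), phaseErrorRate,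
      Matrix.smul_mul, Matrix.trace_smul, smul_eq_mul, ← Complex.ofReal_inv, Complex.re_ofReal_mul,
      mul_inv_cancel_left₀ hg]

/-! ### Phase errors and gains as finite Fock sums -/

theorem ketBra_psiPM (m : ℕ) (s : ℝ) :
    ketBra (psiPM m s) (psiPM m s) =
      ketBra (psi m 0) (psi m 0) + (s : ℂ) • ketBra (psi m 0) (psi m 1) +
        (s : ℂ) • ketBra (psi m 1) (psi m 0) + (s : ℂ) ^ 2 • ketBra (psi m 1) (psi m 1) := by
  have h : psiPM m s = psi m 0 + (s : ℂ) • psi m 1 := by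
    rw [psiPM, psi, psi, if_pos rfl, if_neg one_ne_zero, smul_add, smul_comm (s : ℂ)]
  rw [h]
  simp only [ketBra, map_add, map_smul, ContinuousLinearMap.map_smulₛₗ,
    add_apply, smul_apply, Complex.conj_ofReal]
  module

theorem xProj_apply (s t : ℝ) (x y : Fin 2 × Fin 2) :
    xProj s t x y = 1 / 4 * ((if x.1 = 0 then 1 else (s : ℂ)) * (if x.2 = 0 then 1 else (t : ℂ)) *
      ((if y.1 = 0 then 1 else (s : ℂ)) * (if y.2 = 0 then 1 else (t : ℂ)))) := by
  have hstar : ∀ (r : ℝ) (i : Fin 2), star (xKet r i) = xKet r i := fun r i => by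
    rw [xKet, star_mul', star_one_div_sqrt_two]
    split_ifs <;> simp
  rw [xProj, star_mul', hstar, hstar]
  simp only [xKet]
  have h := one_div_sqrt_two_mul_self
  generalize (1 / Real.sqrt 2 : ℂ) = r at h
  -- This is `r⁴ - 1/4 = (r² + 1/2)(r² - 1/2)`.
  have h4 : r ^ 4 = 1 / 4 := by linear_combination (r * r + 1 / 2) * h
  rw [← h4]
  ring

/-- The prefactor `1/4` of the projector splits in two: one `1/2` is the one in `M_t`, the other
remains in front. -/
theorem trace_taggedState_mul_xProj (μ τ : ℝ) (hμ : 0 ≤ μ) (N : Op →ₗ[ℂ] Op) (m n : ℕ)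
    (s t : ℝ) :
    (taggedState μ τ N m n * xProj s t).trace = (prPhoton μ m : ℂ) * ((1 / 2) *
      ∑ a ∈ Finset.HasAntidiagonal.antidiagonal n, ∑ b ∈ Finset.HasAntidiagonal.antidiagonal n,
        compOp τ t a b * fockEntry (N (ketBra (psiPM m s) (psiPM m s))) a b) := by
  have hcomp : ∑ a ∈ Finset.HasAntidiagonal.antidiagonal n,
      ∑ b ∈ Finset.HasAntidiagonal.antidiagonal n,
        compOp τ t a b * fockEntry (N (ketBra (psiPM m s) (psiPM m s))) a b =
      ∑ a ∈ Finset.HasAntidiagonal.antidiagonal n, ∑ b ∈ Finset.HasAntidiagonal.antidiagonal n,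
        (1 / 2 : ℂ) * (overlap τ 0 0 a b + t * overlap τ 0 1 a b +
          t * overlap τ 1 0 a b + t ^ 2 * overlap τ 1 1 a b) *
            fockEntry (N (ketBra (psiPM m s) (psiPM m s))) a b :=
    Finset.sum_congr rfl fun a ha => Finset.sum_congr rfl fun b hb => by
      rw [compOp_eq τ t ha hb]
  rw [hcomp, Matrix.trace]
  simp only [Matrix.diag_apply, Matrix.mul_apply, taggedState_eq μ τ hμ, xProj_apply,
    ketBra_psiPM, map_add, map_smul, fockEntry_add, fockEntry_smul, Fintype.sum_prod_type,
    Fin.sum_univ_two, Finset.mul_sum, Finset.sum_mul, ← Finset.sum_add_distrib, if_true,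
    one_ne_zero, if_false]
  refine Finset.sum_congr rfl fun a _ => Finset.sum_congr rfl fun b _ => ?_
  ring

theorem overlap_comm (τ : ℝ) (k l : Fin 2) (a b : ℕ × ℕ) :
    overlap τ k l a b = overlap τ l k b a := by
  simp only [overlap, mul_comm]

/-- Within a block the matrix of `M_s` is real symmetric. This reconciles the index order left by
the qubit trace with that of an operator trace. -/
theorem compOp_comm (τ s : ℝ) {n : ℕ} {a b : ℕ × ℕ}
    (ha : a ∈ Finset.HasAntidiagonal.antidiagonal n)
    (hb : b ∈ Finset.HasAntidiagonal.antidiagonal n) : compOp τ s a b = compOp τ s b a := by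
  rw [compOp_eq τ s ha hb, compOp_eq τ s hb ha, overlap_comm τ 0 0 a,
    overlap_comm τ 0 1 a, overlap_comm τ 1 0 a, overlap_comm τ 1 1 a]
  ring

theorem prPhoton_pos {μ : ℝ} (hμ : 0 < μ) (m : ℕ) : 0 < prPhoton μ m := by
  unfold prPhoton; positivity

theorem phaseError_eq_sum (μ τ : ℝ) (hμ : 0 < μ) {N : Op →ₗ[ℂ] Op} (hN : IsChannel N)
    (m n : ℕ) :
    ((gain μ τ N m n * phaseErrorRate μ τ N m n / prPhoton μ m : ℝ) : ℂ) =
      (1 / 2 : ℂ) * ∑ a ∈ Finset.HasAntidiagonal.antidiagonal n,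
        ∑ b ∈ Finset.HasAntidiagonal.antidiagonal n,
          (compOp τ (-1) a b * fockEntry (N (ketBra (psiPM m 1) (psiPM m 1))) b a +
            compOp τ 1 a b * fockEntry (N (ketBra (psiPM m (-1)) (psiPM m (-1)))) b a) := by
  have hp : (prPhoton μ m : ℂ) ≠ 0 := by exact_mod_cast (prPhoton_pos hμ m).ne'
  rw [Complex.ofReal_div, ofReal_gain_mul_phaseErrorRate μ τ hμ.le hN, Matrix.mul_add,
    Matrix.trace_add, trace_taggedState_mul_xProj μ τ hμ.le, trace_taggedState_mul_xProj μ τ hμ.le,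
    ← mul_add, mul_div_cancel_left₀ _ hp, ← mul_add]
  simp only [← Finset.sum_add_distrib]
  congr 1
  rw [Finset.sum_comm]
  refine Finset.sum_congr rfl fun a ha => Finset.sum_congr rfl fun b hb => ?_
  rw [compOp_comm τ _ hb ha, compOp_comm τ 1 hb ha]

/-- Tracing out `A'` produces the reduced input state, and tracing out `B'` keeps only the overlaps
with `k = l`. -/
theorem gain_eq_sum (μ τ : ℝ) (hμ : 0 < μ) {N : Op →ₗ[ℂ] Op} (hN : IsChannel N)
    (m n : ℕ) :
    ((gain μ τ N m n / prPhoton μ m : ℝ) : ℂ) =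
      ∑ a ∈ Finset.HasAntidiagonal.antidiagonal n, ∑ b ∈ Finset.HasAntidiagonal.antidiagonal n,
        fockEntry (N (reducedPsi m)) a b * (overlap τ 0 0 a b + overlap τ 1 1 a b) := by
  have hp : (prPhoton μ m : ℂ) ≠ 0 := by exact_mod_cast (prPhoton_pos hμ m).ne'
  rw [Complex.ofReal_div, ofReal_gain μ τ hμ.le hN, div_eq_iff hp, mul_comm, Matrix.trace]
  simp only [Matrix.diag_apply, taggedState_eq μ τ hμ.le, reducedPsi, map_add, fockEntry_add,
    Fintype.sum_prod_type, Fin.sum_univ_two, ← mul_add, ← Finset.sum_add_distrib]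
  congr 1
  refine Finset.sum_congr rfl fun a _ => Finset.sum_congr rfl fun b _ => ?_
  ring

/-! ### One and two photons -/

theorem sum_antidiagonal_one {M : Type*} [AddCommMonoid M] (f : ℕ × ℕ → M) :
    ∑ a ∈ Finset.HasAntidiagonal.antidiagonal 1, f a = f (0, 1) + f (1, 0) := by
  rw [show Finset.HasAntidiagonal.antidiagonal 1 = ({(0, 1), (1, 0)} : Finset (ℕ × ℕ)) from rfl,
    Finset.sum_pair (by decide)]

theorem sum_antidiagonal_two {M : Type*} [AddCommMonoid M] (f : ℕ × ℕ → M) :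
    ∑ a ∈ Finset.HasAntidiagonal.antidiagonal 2, f a = f (0, 2) + (f (1, 1) + f (2, 0)) := by
  rw [show Finset.HasAntidiagonal.antidiagonal 2 =
    ({(0, 2), (1, 1), (2, 0)} : Finset (ℕ × ℕ)) from rfl,
    Finset.sum_insert (by decide), Finset.sum_pair (by decide)]

theorem inner_fock_apply (X : Op) (i j k l : ℕ) :
    inner ℂ (fock i j) (X (fock k l)) = fockEntry X (i, j) (k, l) := rfl

theorem overlap_zero_zero (τ : ℝ) (i j k l : ℕ) :
    overlap τ 0 0 (i, j) (k, l) = innerOverlap τ i k * outerOverlap τ j l :=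
  overlap_eq τ 0 0 (i, j) (k, l)

theorem overlap_zero_one (τ : ℝ) (i j k l : ℕ) :
    overlap τ 0 1 (i, j) (k, l) = innerOverlap τ i l * outerOverlap τ j k :=
  overlap_eq τ 0 1 (i, j) (k, l)

theorem overlap_one_zero (τ : ℝ) (i j k l : ℕ) :
    overlap τ 1 0 (i, j) (k, l) = innerOverlap τ j k * outerOverlap τ i l :=
  overlap_eq τ 1 0 (i, j) (k, l)

theorem overlap_one_one (τ : ℝ) (i j k l : ℕ) :
    overlap τ 1 1 (i, j) (k, l) = innerOverlap τ j l * outerOverlap τ i k :=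
  overlap_eq τ 1 1 (i, j) (k, l)

theorem compOp_apply (τ s : ℝ) (i j k l : ℕ) (h : k + l = i + j) :
    compOp τ s (i, j) (k, l) = (1 / 2 : ℂ) *
      (innerOverlap τ i k * outerOverlap τ j l + s * (innerOverlap τ i l * outerOverlap τ j k) +
        s * (innerOverlap τ j k * outerOverlap τ i l) +
        s ^ 2 * (innerOverlap τ j l * outerOverlap τ i k)) := by
  rw [compOp_eq τ s (n := i + j) (Finset.HasAntidiagonal.mem_antidiagonal.2 rfl)
    (Finset.HasAntidiagonal.mem_antidiagonal.2 h), overlap_zero_zero, overlap_zero_one,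
    overlap_one_zero, overlap_one_one]
  push_cast
  rfl

theorem innerOverlap_one_zero (τ : ℝ) : innerOverlap τ 1 0 = 0 := by
  rw [innerOverlap_comm, innerOverlap_zero_one]

theorem innerOverlap_two_one (τ : ℝ) : innerOverlap τ 2 1 = 0 := by
  rw [innerOverlap_comm, innerOverlap_one_two]

/-- Once the `ψ_0`–`ψ_1` overlaps vanish, the block of `M_s` has diagonal entries `c₁/2` and
off-diagonal entries `s c₁/2`. -/
theorem phaseError_one (μ τ : ℝ) (hμ : 0 < μ) {N : Op →ₗ[ℂ] Op} (hN : IsChannel N) :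
    ((gain μ τ N 1 1 * phaseErrorRate μ τ N 1 1 / prPhoton μ 1 : ℝ) : ℂ) =
      (cOne τ / 2 : ℂ) *
        (opTrace (N (ketBra (psiPM 1 1) (psiPM 1 1)) ∘L
            ((1 / 2 : ℂ) • ketBra (fock 0 1 - fock 1 0) (fock 0 1 - fock 1 0))) +
          opTrace (N (ketBra (psiPM 1 (-1)) (psiPM 1 (-1))) ∘L
            ((1 / 2 : ℂ) • ketBra (fock 0 1 + fock 1 0) (fock 0 1 + fock 1 0)))) := by
  rw [phaseError_eq_sum μ τ hμ hN]
  simp only [opTrace_comp_smul_ketBra, sum_antidiagonal_one, map_sub, map_add, inner_sub_left,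
    inner_sub_right, inner_add_left, inner_add_right, inner_fock_apply, compOp_apply, cOne_eq,
    innerOverlap_zero_one, innerOverlap_one_zero]
  push_cast
  ring

theorem gain_one (μ τ : ℝ) (hμ : 0 < μ) {N : Op →ₗ[ℂ] Op} (hN : IsChannel N) :
    ((gain μ τ N 1 1 / prPhoton μ 1 : ℝ) : ℂ) =
      (cOne τ : ℂ) * opTrace (N (reducedPsi 1) ∘L
        (ketBra (fock 0 1) (fock 0 1) + ketBra (fock 1 0) (fock 1 0))) := by
  rw [gain_eq_sum μ τ hμ hN]
  simp only [opTrace_comp_ketBra_add, sum_antidiagonal_one, inner_fock_apply, cOne_eq,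
    overlap_zero_zero, overlap_one_one, innerOverlap_zero_one, innerOverlap_one_zero]
  push_cast
  ring

/-- Parity decouples `|11⟩` from `|02⟩` and `|20⟩`, but `ψ_0` and `ψ_2` are both even. Their overlap
therefore adds `s d₂` to the weight of `χ_2^s`. On `|11⟩` the entry of `M_s` is proportional to `(1
+ s)²`, which vanishes for `s = -1`. -/
theorem phaseError_two (μ τ : ℝ) (hμ : 0 < μ) {N : Op →ₗ[ℂ] Op} (hN : IsChannel N) :
    ((gain μ τ N 2 2 * phaseErrorRate μ τ N 2 2 / prPhoton μ 2 : ℝ) : ℂ) =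
      (1 / 2 : ℂ) * (cTwo02 τ - dTwo τ) *
          opTrace (N (ketBra (psiPM 2 1) (psiPM 2 1)) ∘L
            ((1 / 2 : ℂ) • ketBra (fock 0 2 - fock 2 0) (fock 0 2 - fock 2 0))) +
        (1 / 2 : ℂ) * (cTwo02 τ + dTwo τ) *
          opTrace (N (ketBra (psiPM 2 (-1)) (psiPM 2 (-1))) ∘L
            ((1 / 2 : ℂ) • ketBra (fock 0 2 + fock 2 0) (fock 0 2 + fock 2 0))) +
        (1 / 2 : ℂ) * cTwo11 τ *
          opTrace (N (ketBra (psiPM 2 (-1)) (psiPM 2 (-1))) ∘L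
            ketBra (fock 1 1) (fock 1 1)) := by
  rw [phaseError_eq_sum μ τ hμ hN]
  simp only [opTrace_comp_smul_ketBra, opTrace_comp_ketBra, sum_antidiagonal_two, map_sub, map_add,
    inner_sub_left, inner_sub_right, inner_add_left, inner_add_right, inner_fock_apply,
    compOp_apply, cTwo02_eq, cTwo11_eq, dTwo_eq, innerOverlap_zero_one, innerOverlap_one_zero,
    innerOverlap_one_two, innerOverlap_two_one, innerOverlap_comm τ 2 0, outerOverlap_comm τ 2 0]
  push_cast
  ring

theorem gain_two (μ τ : ℝ) (hμ : 0 < μ) {N : Op →ₗ[ℂ] Op} (hN : IsChannel N) :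
    ((gain μ τ N 2 2 / prPhoton μ 2 : ℝ) : ℂ) =
      (cTwo02 τ : ℂ) * opTrace (N (reducedPsi 2) ∘L
          (ketBra (fock 0 2) (fock 0 2) + ketBra (fock 2 0) (fock 2 0))) +
        (cTwo11 τ : ℂ) * opTrace (N (reducedPsi 2) ∘L ketBra (fock 1 1) (fock 1 1)) +
        (dTwo τ : ℂ) * opTrace (N (reducedPsi 2) ∘L
          (ketBra (fock 0 2) (fock 2 0) + ketBra (fock 2 0) (fock 0 2))) := by
  rw [gain_eq_sum μ τ hμ hN]
  simp only [opTrace_comp_ketBra_add, opTrace_comp_ketBra, sum_antidiagonal_two, inner_fock_apply,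
    cTwo02_eq, cTwo11_eq, dTwo_eq, overlap_zero_zero, overlap_one_one, innerOverlap_zero_one,
    innerOverlap_one_zero, innerOverlap_one_two, innerOverlap_two_one, innerOverlap_comm τ 2 0,
    outerOverlap_comm τ 2 0]
  push_cast
  ring

end

end TimeBinCV

open TimeBinCV in
theorem mainTheorem3 (μ τ : ℝ) (hμ : 0 < μ) (N : Op →ₗ[ℂ] Op) (hN : IsChannel N) :
    (∀ m n : ℕ,
      ((gain μ τ N m n * phaseErrorRate μ τ N m n / prPhoton μ m : ℝ) : ℂ) =
        (1 / 2 : ℂ) * opTrace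
          (N (ketBra (psiPM m 1) (psiPM m 1)) ∘L photonBlock n (compOp τ (-1)) +
            N (ketBra (psiPM m (-1)) (psiPM m (-1))) ∘L photonBlock n (compOp τ 1))) ∧
    (((gain μ τ N 1 1 * phaseErrorRate μ τ N 1 1 / prPhoton μ 1 : ℝ) : ℂ) =
      (cOne τ / 2 : ℂ) *
        (opTrace (N (ketBra (psiPM 1 1) (psiPM 1 1)) ∘L
            ((1 / 2 : ℂ) • ketBra (fock 0 1 - fock 1 0) (fock 0 1 - fock 1 0))) +
          opTrace (N (ketBra (psiPM 1 (-1)) (psiPM 1 (-1))) ∘L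
            ((1 / 2 : ℂ) • ketBra (fock 0 1 + fock 1 0) (fock 0 1 + fock 1 0))))) ∧
    (((gain μ τ N 1 1 / prPhoton μ 1 : ℝ) : ℂ) =
      (cOne τ : ℂ) * opTrace (N (reducedPsi 1) ∘L
        (ketBra (fock 0 1) (fock 0 1) + ketBra (fock 1 0) (fock 1 0)))) ∧
    (((gain μ τ N 2 2 * phaseErrorRate μ τ N 2 2 / prPhoton μ 2 : ℝ) : ℂ) =
      (1 / 2 : ℂ) * (cTwo02 τ - dTwo τ) *
          opTrace (N (ketBra (psiPM 2 1) (psiPM 2 1)) ∘L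
            ((1 / 2 : ℂ) • ketBra (fock 0 2 - fock 2 0) (fock 0 2 - fock 2 0))) +
        (1 / 2 : ℂ) * (cTwo02 τ + dTwo τ) *
          opTrace (N (ketBra (psiPM 2 (-1)) (psiPM 2 (-1))) ∘L
            ((1 / 2 : ℂ) • ketBra (fock 0 2 + fock 2 0) (fock 0 2 + fock 2 0))) +
        (1 / 2 : ℂ) * cTwo11 τ *
          opTrace (N (ketBra (psiPM 2 (-1)) (psiPM 2 (-1))) ∘L
            ketBra (fock 1 1) (fock 1 1))) ∧
    (((gain μ τ N 2 2 / prPhoton μ 2 : ℝ) : ℂ) =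
      (cTwo02 τ : ℂ) * opTrace (N (reducedPsi 2) ∘L
          (ketBra (fock 0 2) (fock 0 2) + ketBra (fock 2 0) (fock 2 0))) +
        (cTwo11 τ : ℂ) * opTrace (N (reducedPsi 2) ∘L ketBra (fock 1 1) (fock 1 1)) +
        (dTwo τ : ℂ) * opTrace (N (reducedPsi 2) ∘L
          (ketBra (fock 0 2) (fock 2 0) + ketBra (fock 2 0) (fock 0 2)))) := by
  refine ⟨fun m n => ?_, phaseError_one μ τ hμ hN, gain_one μ τ hμ hN, phaseError_two μ τ hμ hN,
    gain_two μ τ hμ hN⟩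
  rw [phaseError_eq_sum μ τ hμ hN, opTrace_comp_photonBlock_add]
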